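/- Let $B$ be the open unit disc in $\mathbb{R}^2$ centred at $0$, $R=|x|$, $e_\theta(x)=(-x_2,x_1)/|x|$, and let $u\in W^{1,1}(B,\mathbb{R}^m)$ have weak gradient $\nabla u$ (an $m\times 2$ matrix field) with $|\nabla u|\ln(2+|\nabla u|)\in L^1(B)$. Here $F\cdot G=\mathrm{tr}(F^TG)$ and $|F|^2=F\cdot F$ for matrices. Write $u_{,\tau}=\nabla u\,e_\theta$ $(=R^{-1}u_{,\theta})$, and for $F\in\mathbb{R}^{m\times 2}$ and $1\le i<j\le m$ let $F^{(i,j)}$ be the $2\times2$ matrix formed by rows $i$ and $j$ of $F$, and $H_{ij}(F)=\det F^{(i,j)}$. Integrals over $B$ containing the factor $1/R$ need not converge absolutely at the origin; they are understood as $\lim_{\varepsilon\downarrow0}\int_{\{\varepsilon<|x|<1\}}$ (with integrand integrable on each of these annuli), which is the Lebesgue integral whenever the integrand is integrable on $B$. (a) For all $1\le i<j\le m$ and all $\varphi\in C_c^\infty(B,\mathbb{R}^m)$, the function $\ln R\;DH_{ij}(\nabla u)\cdot\nabla\varphi$ is integrable on $B$, the limit defining the right-hand side below exists, and $$\int_B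 \ln R\; DH_{ij}(\nabla u)\cdot\nabla\varphi\,dx=\int_B\left(u_{i,\tau}\varphi_j-u_{j,\tau}\varphi_i\right)\frac{dx}{R}.$$ (b) Let $\lambda_{ij}\in\mathbb{R}$ $(1\le i<j\le m)$, let $\Lambda$ be the antisymmetric $m\times m$ matrix with $\Lambda_{ij}=\lambda_{ij}$ for $i<j$, and let $f:[0,\infty)\to\mathbb{R}$ be such that $\gamma(F)=f(|F|)$ is differentiable at $\nabla u(x)$ for a.e. $x\in B$, with $D\gamma(\nabla u)\in L^1(B)$. Then for every $\varphi\in C_c^\infty(B,\mathbb{R}^m)$ the integrand on the left below is integrable on $B$, the limit on the right exists, and $$\int_B D\gamma(\nabla u)\cdot\nabla\varphi+\sum_{1\le i<j\le m}\lambda_{ij}\ln R\;\mathrm{cof}\,(\nabla u)^{(i,j)}\cdot\nabla\varphi^{(i,j)}\,dx=\int_B D\gamma(\nabla u)\cdot\nabla\varphi-\Lambda u_{,\tau}\cdot\frac{\varphi}{R}\,dx.$$ Consequently $u$ is a critical point of $\int_B W(x,\nabla u)\,dx$, $W(x,F)=f(|F|)+\sum_{i<j}\lambda_{ij}\ln|x|\det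 F^{(i,j)}$, that is, the left-hand side vanishes for all $\varphi\in C_c^\infty(B,\mathbb{R}^m)$, if and only if $$\int_B D\gamma(\nabla u)\cdot\nabla\varphi-\Lambda u_{,\tau}\cdot\frac{\varphi}{R}\,dx=0\qquad\text{for all }\varphi\in C_c^\infty(B,\mathbb{R}^m).$$ -/

import Mathlib

open MeasureTheory Filter Topology
open scoped ContDiff

noncomputable section

namespace OneHomog

/-- The plane `ℝ²` with its Euclidean norm. -/
abbrev Plane := EuclideanSpace ℝ (Fin 2)

/-- The target space `ℝᵐ`. -/
abbrev Vec (m : ℕ) := EuclideanSpace ℝ (Fin m)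

/-- The space `ℝ^{m × 2}` of matrices, with inner product `F · G = tr (Fᵀ G) = ∑ F_{ik} G_{ik}` and
the associated (Frobenius) norm. The `(i, k)` entry of `F` is `F (i, k)`. -/
abbrev Mat (m : ℕ) := EuclideanSpace ℝ (Fin m × Fin 2)

/-- The open unit ball `B` centred at `0`. -/
def unitBall : Set Plane := Metric.ball 0 1

/-- The open annulus `{x : ε < |x| < 1}`. -/
def annulus (ε : ℝ) : Set Plane := {x | ε < ‖x‖ ∧ ‖x‖ < 1}

/-- `φ ∈ C_c^∞(B, E)`: a smooth function whose support is a compact subset of the open ball `B`. -/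
structure IsTest {E : Type*} [NormedAddCommGroup E] [NormedSpace ℝ E] (φ : Plane → E) : Prop where
  smooth : ContDiff ℝ ∞ φ
  compact : HasCompactSupport φ
  support : tsupport φ ⊆ unitBall

/-- The classical gradient, `(∇φ)_{ik} = ∂φ_i / ∂x_k`. -/
def grad {m : ℕ} (φ : Plane → Vec m) (x : Plane) : Mat m :=
  WithLp.toLp 2 fun p => fderiv ℝ φ x (EuclideanSpace.single p.2 1) p.1

/-- `u` belongs to `W^{1,1}(B, ℝᵐ)` and `Du` is (a representative of) its weak gradient `∇u`. -/
structure IsW11WithGradient {m : ℕ} (u : Plane → Vec m) (Du : Plane → Mat m) : Prop where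
  integrable : IntegrableOn u unitBall
  integrable_gradient : IntegrableOn Du unitBall
  weak : ∀ (i : Fin m) (k : Fin 2) (ψ : Plane → ℝ), IsTest ψ →
    ∫ x in unitBall, u x i * fderiv ℝ ψ x (EuclideanSpace.single k 1) =
      -∫ x in unitBall, Du x (i, k) * ψ x

/-- The unit tangential vector `e_θ = (-sin θ, cos θ) = (-x₂, x₁) / |x|`. -/
def eTheta (x : Plane) : Plane := !₂[-(x 1) / ‖x‖, x 0 / ‖x‖]

/-- The tangential derivative `u_{,τ} = R⁻¹ u_{,θ}`, which in terms of the gradient is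
`u_{,τ} = (∇u) e_θ`. -/
def tau {m : ℕ} (Du : Plane → Mat m) (x : Plane) : Vec m :=
  WithLp.toLp 2 fun i => ∑ k, Du x (i, k) * eTheta x k

/-- The `2 × 2` submatrix `F^{(i,j)}` formed by rows `i` and `j` of `F`. -/
def sub {m : ℕ} (i j : Fin m) (F : Mat m) : Matrix (Fin 2) (Fin 2) ℝ :=
  !![F (i, 0), F (i, 1); F (j, 0), F (j, 1)]

/-- `H_{ij}(F) = det F^{(i,j)}`. -/
def H {m : ℕ} (i j : Fin m) (F : Mat m) : ℝ := (sub i j F).det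

/-- The cofactor matrix `cof A`. -/
def cof (A : Matrix (Fin 2) (Fin 2) ℝ) : Matrix (Fin 2) (Fin 2) ℝ := A.adjugate.transpose

/-- The inner product `A · C = tr (Aᵀ C)` of two `2 × 2` matrices. -/
def dot2 (A C : Matrix (Fin 2) (Fin 2) ℝ) : ℝ := (A.transpose * C).trace

/-- `γ(F) = f(|F|)`. -/
def gam {m : ℕ} (f : ℝ → ℝ) (F : Mat m) : ℝ := f ‖F‖

/-- The antisymmetric matrix `Λ` built from the coefficients `λ_{ij}`, `i < j`. -/
def Lam {m : ℕ} (lam : Fin m → Fin m → ℝ) : Matrix (Fin m) (Fin m) ℝ :=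
  Matrix.of fun i j => if i < j then lam i j else if j < i then -lam j i else 0

/-- The integrand of the weak Euler-Lagrange equation of
`W(x, F) = f(|F|) + ∑_{i<j} λ_{ij} ln|x| det F^{(i,j)}`, namely
`Dγ(∇u)·∇φ + ∑_{i<j} λ_{ij} ln R cof (∇u)^{(i,j)} · ∇φ^{(i,j)}`. -/
def elIntegrand {m : ℕ} (f : ℝ → ℝ) (lam : Fin m → Fin m → ℝ) (Du : Plane → Mat m)
    (φ : Plane → Vec m) (x : Plane) : ℝ :=
  inner ℝ (gradient (gam f) (Du x)) (grad φ x) +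
    ∑ i, ∑ j ∈ Finset.Ioi i,
      lam i j * (Real.log ‖x‖ * dot2 (cof (sub i j (Du x))) (sub i j (grad φ x)))

/-- A map with weak gradient `Du` is a critical (stationary) point of `∫_B W(x, ∇u) dx`: the weak
Euler-Lagrange equation holds for every test function. -/
def IsCriticalPoint {m : ℕ} (f : ℝ → ℝ) (lam : Fin m → Fin m → ℝ) (Du : Plane → Mat m) : Prop :=
  ∀ φ : Plane → Vec m, IsTest φ →
    IntegrableOn (elIntegrand f lam Du φ) unitBall ∧
      ∫ x in unitBall, elIntegrand f lam Du φ x = 0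

/-- The integrand `Dγ(∇u)·∇φ - Λ u_{,τ} · φ / R`. -/
def reducedIntegrand {m : ℕ} (f : ℝ → ℝ) (lam : Fin m → Fin m → ℝ) (Du : Plane → Mat m)
    (φ : Plane → Vec m) (x : Plane) : ℝ :=
  inner ℝ (gradient (gam f) (Du x)) (grad φ x) -
    (∑ i, (Lam lam).mulVec (tau Du x) i * φ x i) / ‖x‖

/-- `∫_B g dx = a`, where the singularity of `g` at the origin is treated as an improper integral:
`g` is integrable on every annulus `{ε < |x| < 1}` and its integral there tends to `a` as `ε ↓ 0`.
If `g` is integrable on `B`, this says that its Lebesgue integral over `B` is `a`. -/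
def HasImproperIntegral (g : Plane → ℝ) (a : ℝ) : Prop :=
  (∀ ε > 0, IntegrableOn g (annulus ε)) ∧
    Tendsto (fun ε : ℝ => ∫ x in annulus ε, g x) (𝓝[>] 0) (𝓝 a)

end OneHomog

end

/-! The pairing of `DH_{ij}(∇u)` with `∇φ` is a difference of two determinants, each with one row of
`∇u` and one row of `∇φ`. A row of a weak gradient is curl free, so `∫ det(∇u_i, ∇ψ) = 0` for every
test function `ψ` (`integral_rowDet_eq_zero`). Use `g(|x|²) ψ` in place of `ψ`: the gradient of
`g(|x|²)` is radial, so the product rule leaves `g det(∇u_i, ∇ψ)` minus `2|x|² g'(|x|²) u_{i,τ} ψ /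
|x|` (`rowDet_radial_mul`). For `g(t) = ½ ln t` the factor `2 t g'(t)` is 1, which is formally the
claim.

The logarithm is singular at the origin, so `g` is first a smooth approximation of `½ ln max(t,
ε²)`. Removing the smoothing gives an exact identity on `{ε < |x| < 1}` (`integral_annulus_tau`).
Then `ε ↓ 0` by dominated convergence with majorant `|ln R| |det(∇u_i, ∇ψ)|`. Its integrability is
where `|∇u| ln(2 + |∇u|) ∈ L¹` enters, through a Young inequality pairing `s ln(2 + s)` with `exp`
(`integrableOn_log_mul`). Part (b) is linear algebra on top of (a). -/

noncomputable section

namespace OneHomog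

/-! ### Truncated logarithms, their smoothings, and a Young inequality -/

section Cutoff

/-- A smooth approximation of the function equal to `1 / (2 s)` for `s > a` and to `0` otherwise. -/
def stepWeight (a : ℝ) (n : ℕ) (s : ℝ) : ℝ := Real.smoothTransition (n * (s - a)) * (2 * s)⁻¹

/-- The primitive of `stepWeight a n` that vanishes at `1`, a smooth approximation of
`½ ln max(t, a)`. -/
def cutLog (a : ℝ) (n : ℕ) (t : ℝ) : ℝ := ∫ s in (1 : ℝ)..t, stepWeight a n s

/-- The function `½ ln max(t, a)`, for `0 < a < 1`, written as an integral. -/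
def truncLog (a t : ℝ) : ℝ := ∫ s in (1 : ℝ)..t, (Set.Ioi a).indicator (fun s => (2 * s)⁻¹) s

variable {a : ℝ}

lemma stepWeight_of_le {n : ℕ} {s : ℝ} (h : s ≤ a) : stepWeight a n s = 0 := by
  rw [stepWeight, Real.smoothTransition.zero_of_nonpos, zero_mul]
  exact mul_nonpos_of_nonneg_of_nonpos n.cast_nonneg (by linarith)

/-- The pole of `(2 s)⁻¹` at 0 lies in `s < a`, where the transition factor vanishes identically. -/
lemma contDiff_stepWeight (ha : 0 < a) (n : ℕ) : ContDiff ℝ ∞ (stepWeight a n) := by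
  rw [contDiff_iff_contDiffAt]
  intro s
  rcases lt_or_ge s a with h | h
  · refine (contDiffAt_const (c := (0 : ℝ))).congr_of_eventuallyEq ?_
    filter_upwards [Iio_mem_nhds h] with y hy using stepWeight_of_le (le_of_lt hy)
  · unfold stepWeight
    refine ContDiffAt.mul ?_ ?_
    · exact (Real.smoothTransition.contDiff.comp
        (contDiff_const.mul (contDiff_id.sub contDiff_const))).contDiffAt
    · exact (contDiffAt_const.mul contDiffAt_id).inv (by simp; linarith)

lemma norm_stepWeight_le (ha : 0 < a) (n : ℕ) (s : ℝ) : ‖stepWeight a n s‖ ≤ (2 * a)⁻¹ := by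
  rcases le_or_gt s a with h | h
  · rw [stepWeight_of_le h]; simp; positivity
  · have hs : 0 < s := ha.trans h
    rw [stepWeight, norm_mul, Real.norm_of_nonneg (Real.smoothTransition.nonneg _),
      Real.norm_of_nonneg (by positivity)]
    calc _ ≤ 1 * (2 * s)⁻¹ := 
        mul_le_mul_of_nonneg_right (Real.smoothTransition.le_one _) (by positivity)
      _ ≤ _ := by rw [one_mul]; gcongr

lemma tendsto_stepWeight (s : ℝ) : Tendsto (fun n => stepWeight a n s) atTop
    (𝓝 ((Set.Ioi a).indicator (fun s => (2 * s)⁻¹) s)) := by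
  rcases le_or_gt s a with h | h
  · simp [stepWeight_of_le h, h]
  · rw [Set.indicator_of_mem (show s ∈ Set.Ioi a from h)]
    refine tendsto_const_nhds.congr' ?_
    have : Tendsto (fun n : ℕ => (n : ℝ) * (s - a)) atTop atTop :=
      tendsto_natCast_atTop_atTop.atTop_mul_const (sub_pos.2 h)
    filter_upwards [this.eventually_ge_atTop 1] with n hn
    rw [stepWeight, Real.smoothTransition.one_of_one_le hn, one_mul]

lemma hasDerivAt_cutLog (ha : 0 < a) (n : ℕ) (t : ℝ) :
    HasDerivAt (cutLog a n) (stepWeight a n t) t :=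
  have hc := (contDiff_stepWeight ha n).continuous
  intervalIntegral.integral_hasDerivAt_right (hc.intervalIntegrable _ _)
    (hc.stronglyMeasurableAtFilter _ _) hc.continuousAt

lemma contDiff_cutLog (ha : 0 < a) (n : ℕ) : ContDiff ℝ ∞ (cutLog a n) := by
  rw [contDiff_infty_iff_deriv]
  refine ⟨fun t => (hasDerivAt_cutLog ha n t).differentiableAt, ?_⟩
  rw [show deriv (cutLog a n) = stepWeight a n from
    funext fun t => (hasDerivAt_cutLog ha n t).deriv]
  exact contDiff_stepWeight ha n

lemma norm_cutLog_le (ha : 0 < a) (n : ℕ) (t : ℝ) : ‖cutLog a n t‖ ≤ (2 * a)⁻¹ * |t - 1| :=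
  intervalIntegral.norm_integral_le_of_norm_le_const fun s _ => norm_stepWeight_le ha n s

lemma tendsto_cutLog (ha : 0 < a) (t : ℝ) :
    Tendsto (fun n => cutLog a n t) atTop (𝓝 (truncLog a t)) := by
  refine intervalIntegral.tendsto_integral_filter_of_dominated_convergence
    (fun _ => (2 * a)⁻¹) (.of_forall fun n => ?_) (.of_forall fun n => .of_forall fun s _ => ?_)
    (by simp) (.of_forall fun s _ => tendsto_stepWeight s)
  · exact (contDiff_stepWeight ha n).continuous.aestronglyMeasurable
  · exact norm_stepWeight_le ha n s

lemma integral_inv_two_mul {t : ℝ} (ht : 0 < t) :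
    ∫ s in (1 : ℝ)..t, (2 * s)⁻¹ = Real.log t / 2 := by
  simp_rw [mul_inv]
  rw [intervalIntegral.integral_const_mul, integral_inv_of_pos one_pos ht, div_one]
  ring

lemma intervalIntegrable_inv_two_mul {t : ℝ} (ht : 0 < t) :
    IntervalIntegrable (fun s : ℝ => (2 * s)⁻¹) volume 1 t := by
  refine ContinuousOn.intervalIntegrable (ContinuousOn.inv₀ (by fun_prop) fun s hs => ?_)
  have := (lt_min one_pos ht).trans_le hs.1
  positivity

lemma norm_truncLog_le {t : ℝ} (ht : 0 < t) :
    ‖truncLog a t‖ ≤ |Real.log t / 2| := by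
  rw [← integral_inv_two_mul ht]
  refine intervalIntegral.norm_integral_le_abs_of_norm_le ?_ (intervalIntegrable_inv_two_mul ht)
  filter_upwards [ae_restrict_mem measurableSet_uIoc] with s hs
  have hs0 : 0 < s := (lt_min one_pos ht).trans hs.1
  refine (norm_indicator_le_norm_self _ _).trans ?_
  rw [Real.norm_of_nonneg (by positivity)]

lemma truncLog_of_lt {t : ℝ} (ha : 0 < a) (ha1 : a < 1) (hat : a < t) :
    truncLog a t = Real.log t / 2 := by
  rw [← integral_inv_two_mul (ha.trans hat)]
  refine intervalIntegral.integral_congr fun s hs => ?_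
  -- Both endpoints 1 and `t` exceed `a`, so the truncation is inactive on the whole interval.
  exact Set.indicator_of_mem (show s ∈ Set.Ioi a from (lt_min ha1 hat).trans_le hs.1) _

/-- Either `t ≤ 2 ln(2 + s)`, and the first term suffices, or `s ≤ exp(t/2)`, and `t ≤ 2 exp(t/2)`
gives the second. -/
lemma mul_le_mul_log_add_exp {s t : ℝ} (hs : 0 ≤ s) :
    t * s ≤ 2 * (s * Real.log (2 + s)) + 2 * Real.exp t := by
  have h2 : 0 < 2 + s := by linarith
  have hl : 0 ≤ Real.log (2 + s) := Real.log_nonneg (by linarith)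
  rcases le_total t (2 * Real.log (2 + s)) with h | h
  · nlinarith [mul_le_mul_of_nonneg_right h hs, Real.exp_pos t]
  · have h1 : s ≤ Real.exp (t / 2) := by
      have : 2 + s ≤ Real.exp (t / 2) := by
        rw [← Real.log_le_iff_le_exp h2]; linarith
      linarith
    have h3 : t ≤ 2 * Real.exp (t / 2) := by linarith [Real.add_one_le_exp (t / 2)]
    have h4 : Real.exp t = Real.exp (t / 2) * Real.exp (t / 2) := by
      rw [← Real.exp_add]; ring_nf
    have h5 := mul_le_mul h3 h1 hs (by positivity)
    have h6 := mul_nonneg hs hl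
    nlinarith

end Cutoff

variable {m : ℕ}

/-! ### Operations on test functions -/

section Test

variable {E F : Type*} [NormedAddCommGroup E] [NormedSpace ℝ E]
  [NormedAddCommGroup F] [NormedSpace ℝ F]

lemma IsTest.fderiv_apply {ψ : Plane → E} (hψ : IsTest ψ) (v : Plane) :
    IsTest (fun x => fderiv ℝ ψ x v) where
  smooth := (hψ.smooth.fderiv_right (m := ∞) le_rfl).clm_apply contDiff_const
  compact := hψ.compact.fderiv_apply ℝ v
  support := (tsupport_fderiv_apply_subset ℝ v).trans hψ.support

lemma IsTest.clm_comp {φ : Plane → E} (hφ : IsTest φ) (L : E →L[ℝ] F) :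
    IsTest (fun x => L (φ x)) where
  smooth := L.contDiff.comp hφ.smooth
  compact := hφ.compact.comp_left (map_zero L)
  support := (closure_mono (Function.support_comp_subset (map_zero L) φ)).trans hφ.support

lemma IsTest.mul_left {ψ : Plane → ℝ} (hψ : IsTest ψ) {g : Plane → ℝ} (hg : ContDiff ℝ ∞ g) :
    IsTest (fun x => g x * ψ x) where
  smooth := hg.mul hψ.smooth
  compact := hψ.compact.mul_left
  support := (tsupport_mul_subset_right).trans hψ.support

lemma IsTest.exists_bound {φ : Plane → E} (hφ : IsTest φ) : ∃ C, ∀ x, ‖φ x‖ ≤ C :=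
  hφ.compact.exists_bound_of_continuous hφ.smooth.continuous

lemma IsTest.integrableOn_mul {ψ g : Plane → ℝ} (hψ : IsTest ψ) {s : Set Plane}
    (hg : IntegrableOn g s) : IntegrableOn (fun x => g x * ψ x) s := by
  obtain ⟨C, hC⟩ := hψ.exists_bound
  exact Integrable.mul_bdd hg hψ.smooth.continuous.aestronglyMeasurable (.of_forall hC)

lemma isTest_coord {φ : Plane → Vec m} (hφ : IsTest φ) (i : Fin m) : IsTest (fun x => φ x i) :=
  hφ.clm_comp (EuclideanSpace.proj i : Vec m →L[ℝ] ℝ)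

lemma grad_apply {φ : Plane → Vec m} (hφ : IsTest φ) (x : Plane) (i : Fin m) (k : Fin 2) :
    grad φ x (i, k) = fderiv ℝ (fun y => φ y i) x (EuclideanSpace.single k 1) := by
  have h := (hφ.smooth.differentiable (by simp) x).hasFDerivAt
  have h2 : HasFDerivAt (fun y => φ y i) _ x :=
    (EuclideanSpace.proj i : Vec m →L[ℝ] ℝ).hasFDerivAt.comp x h
  rw [h2.fderiv]
  simp [grad]

end Test

/-! ### Determinants of a gradient row against a test gradient -/

lemma fderiv_fderiv_comm {ψ : Plane → ℝ} (hψ : IsTest ψ) (x v w : Plane) :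
    fderiv ℝ (fun y => fderiv ℝ ψ y v) x w = fderiv ℝ (fun y => fderiv ℝ ψ y w) x v := by
  have hd : DifferentiableAt ℝ (fderiv ℝ ψ) x :=
    (hψ.smooth.fderiv_right (m := ∞) le_rfl).differentiable (by simp) x
  have hs : IsSymmSndFDerivAt ℝ ψ x :=
    (contDiff_infty.1 hψ.smooth 2).contDiffAt.isSymmSndFDerivAt (by simp)
  have key (v w : Plane) :
      fderiv ℝ (fun y => fderiv ℝ ψ y v) x w = fderiv ℝ (fderiv ℝ ψ) x w v := by
    rw [fderiv_clm_apply hd (by fun_prop)]; simp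
  rw [key, key, hs.eq]

/-- The determinant of the matrix with rows `F_i` and `∇ψ(x)`. -/
def rowDet (F : Mat m) (i : Fin m) (ψ : Plane → ℝ) (x : Plane) : ℝ :=
  F (i, 0) * fderiv ℝ ψ x (EuclideanSpace.single 1 1) -
    F (i, 1) * fderiv ℝ ψ x (EuclideanSpace.single 0 1)

variable {u : Plane → Vec m} {Du : Plane → Mat m}

lemma integrableOn_entry {s : Set Plane} (h : IntegrableOn Du s) (p : Fin m × Fin 2) :
    IntegrableOn (fun x => Du x p) s :=
  (EuclideanSpace.proj p : Mat m →L[ℝ] ℝ).integrable_comp h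

lemma integrableOn_rowDet {w : Plane → ℝ} {s : Set Plane}
    (h : ∀ p, IntegrableOn (fun x => w x * Du x p) s) (i : Fin m)
    {ψ : Plane → ℝ} (hψ : IsTest ψ) :
    IntegrableOn (fun x => w x * rowDet (Du x) i ψ x) s := by
  refine (((hψ.fderiv_apply (EuclideanSpace.single 1 1)).integrableOn_mul (h (i, 0))).sub
    ((hψ.fderiv_apply (EuclideanSpace.single 0 1)).integrableOn_mul (h (i, 1)))).congr (.of_forall fun x => ?_)
  simp only [rowDet, Pi.sub_apply]
  ring

lemma integral_rowDet_eq_zero (hu : IsW11WithGradient u Du) (i : Fin m) {ψ : Plane → ℝ}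
    (hψ : IsTest ψ) : ∫ x in unitBall, rowDet (Du x) i ψ x = 0 := by
  have h0 := hu.weak i 0 _ (hψ.fderiv_apply (EuclideanSpace.single 1 1))
  have h1 := hu.weak i 1 _ (hψ.fderiv_apply (EuclideanSpace.single 0 1))
  -- Equality of mixed derivatives makes the left sides of `h0` and `h1` agree, so their right sides
  -- cancel.
  simp_rw [fderiv_fderiv_comm hψ _ (EuclideanSpace.single 1 1)] at h0
  simp only [rowDet]
  rw [integral_sub ((hψ.fderiv_apply _).integrableOn_mul
      (integrableOn_entry hu.integrable_gradient (i, 0)))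
    ((hψ.fderiv_apply _).integrableOn_mul (integrableOn_entry hu.integrable_gradient (i, 1)))]
  linarith

lemma fderiv_radial_mul {g g' : ℝ → ℝ} (hg : ∀ t, HasDerivAt g (g' t) t) {ψ : Plane → ℝ}
    (hψ : IsTest ψ) (x : Plane) (k : Fin 2) :
    fderiv ℝ (fun y => g (‖y‖ ^ 2) * ψ y) x (EuclideanSpace.single k 1) =
      g (‖x‖ ^ 2) * fderiv ℝ ψ x (EuclideanSpace.single k 1) +
        ψ x * (g' (‖x‖ ^ 2) * (2 * x k)) := by
  have h1 := (hasStrictFDerivAt_norm_sq x).hasFDerivAt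
  have h2 := (hg (‖x‖ ^ 2)).comp_hasFDerivAt x h1
  have h3 := h2.mul (hψ.smooth.differentiable (by simp) x).hasFDerivAt
  have h4 : fderiv ℝ (fun y => g (‖y‖ ^ 2) * ψ y) x = _ := h3.fderiv
  rw [h4]
  simp [EuclideanSpace.inner_single_right]

lemma tau_apply (x : Plane) (i : Fin m) :
    tau Du x i = (Du x (i, 1) * x 0 - Du x (i, 0) * x 1) / ‖x‖ := by
  simp [tau, eTheta, Fin.sum_univ_two]
  ring

lemma norm_tau_apply_le (x : Plane) (i : Fin m) : ‖tau Du x i‖ ≤ ‖Du x‖ + ‖Du x‖ := by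
  have h (k : Fin 2) : ‖eTheta x k‖ ≤ 1 := by
    have hk (l : Fin 2) : ‖x l / ‖x‖‖ ≤ 1 := by
      rw [norm_div, norm_norm]
      exact div_le_one_of_le₀ (PiLp.norm_apply_le x l) (norm_nonneg _)
    fin_cases k
    · simpa [eTheta, neg_div] using hk 1
    · simpa [eTheta] using hk 0
  simp only [tau, Fin.sum_univ_two]
  refine (norm_add_le _ _).trans ?_
  simp only [norm_mul]
  exact add_le_add
    ((mul_le_of_le_one_right (norm_nonneg _) (h 0)).trans (PiLp.norm_apply_le _ _))
    ((mul_le_of_le_one_right (norm_nonneg _) (h 1)).trans (PiLp.norm_apply_le _ _))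

/-- Against the radial vector `x`, the determinant sees only the tangential part: `det(F_i, x) =
-|x| F_i · e_θ`. The variable `|x|²` keeps the multiplier smooth at the origin. -/
lemma rowDet_radial_mul {g g' : ℝ → ℝ} (hg : ∀ t, HasDerivAt g (g' t) t) {ψ : Plane → ℝ}
    (hψ : IsTest ψ) (x : Plane) (i : Fin m) :
    rowDet (Du x) i (fun y => g (‖y‖ ^ 2) * ψ y) x =
      g (‖x‖ ^ 2) * rowDet (Du x) i ψ x -
        2 * ‖x‖ ^ 2 * g' (‖x‖ ^ 2) * (tau Du x i * ψ x / ‖x‖) := by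
  rw [rowDet, fderiv_radial_mul hg hψ, fderiv_radial_mul hg hψ, tau_apply, rowDet]
  rcases eq_or_ne x 0 with rfl | hx
  · simp; ring
  · have := norm_ne_zero_iff.2 hx
    field_simp
    ring

/-! ### The identity on annuli and its limit at the origin -/

lemma measurableSet_annulus (ε : ℝ) : MeasurableSet (annulus ε) :=
  (measurableSet_lt measurable_const measurable_norm).inter
    (measurableSet_lt measurable_norm measurable_const)

lemma measurableSet_unitBall : MeasurableSet unitBall := measurableSet_ball

lemma annulus_subset_unitBall (ε : ℝ) : annulus ε ⊆ unitBall := fun _ hx =>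
  mem_ball_zero_iff.2 hx.2

lemma aestronglyMeasurable_tau {s : Set Plane} (h : IntegrableOn Du s) (i : Fin m) :
    AEStronglyMeasurable (fun x => tau Du x i) (volume.restrict s) := by
  simp_rw [tau_apply]
  have h0 := (integrableOn_entry h (i, 0)).aestronglyMeasurable.aemeasurable
  have h1 := (integrableOn_entry h (i, 1)).aestronglyMeasurable.aemeasurable
  have hx (k : Fin 2) : Measurable fun x : Plane => x k := by fun_prop
  exact (((h1.mul (hx 0).aemeasurable).sub (h0.mul (hx 1).aemeasurable)).div
    measurable_norm.aemeasurable).aestronglyMeasurable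

lemma integrableOn_tau_div_norm (h : IntegrableOn Du unitBall) (i : Fin m) {ψ : Plane → ℝ}
    (hψ : IsTest ψ) {ε : ℝ} (hε : 0 < ε) :
    IntegrableOn (fun x => tau Du x i * ψ x / ‖x‖) (annulus ε) := by
  have h' := h.mono_set (annulus_subset_unitBall ε)
  have ht : IntegrableOn (fun x => tau Du x i) (annulus ε) :=
    (h'.norm.add h'.norm).mono' (aestronglyMeasurable_tau h' i)
      (.of_forall fun x => norm_tau_apply_le x i)
  simp_rw [div_eq_mul_inv]
  refine (hψ.integrableOn_mul ht).mul_bdd (c := ε⁻¹)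
    measurable_norm.inv.aestronglyMeasurable ?_
  filter_upwards [ae_restrict_mem (measurableSet_annulus ε)] with x hx
  rw [norm_inv, norm_norm]
  exact inv_anti₀ hε hx.1.le

/-- The factor `2 t` cancels the weight and leaves the transition, with values in `[0, 1]`; the
bound is uniform in `n`, as domination requires. -/
lemma norm_two_mul_stepWeight_le {a : ℝ} (ha : 0 < a) (n : ℕ) (t : ℝ) :
    ‖2 * t * stepWeight a n t‖ ≤ 1 := by
  rcases le_or_gt t a with h | h
  · simp [stepWeight_of_le h]
  · have ht : 2 * t ≠ 0 := by linarith
    rw [stepWeight, mul_left_comm, mul_inv_cancel₀ ht, mul_one,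
      Real.norm_of_nonneg (Real.smoothTransition.nonneg _)]
    exact Real.smoothTransition.le_one _

lemma integrableOn_rowDet_unitBall (h : IntegrableOn Du unitBall) (i : Fin m) {ψ : Plane → ℝ}
    (hψ : IsTest ψ) : IntegrableOn (fun x => rowDet (Du x) i ψ x) unitBall := by
  simpa using integrableOn_rowDet (w := fun _ => 1)
    (fun p => by simpa using integrableOn_entry h p) i hψ

lemma integral_cutLog_mul_rowDet (hu : IsW11WithGradient u Du) (i : Fin m) {ψ : Plane → ℝ}
    (hψ : IsTest ψ) {a : ℝ} (ha : 0 < a) (n : ℕ) :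
    ∫ x in unitBall, cutLog a n (‖x‖ ^ 2) * rowDet (Du x) i ψ x =
      ∫ x in unitBall, 2 * ‖x‖ ^ 2 * stepWeight a n (‖x‖ ^ 2) * (tau Du x i * ψ x / ‖x‖) := by
  have hΨ : IsTest fun y => cutLog a n (‖y‖ ^ 2) * ψ y :=
    hψ.mul_left ((contDiff_cutLog ha n).comp (contDiff_norm_sq ℝ))
  have h0 := integral_rowDet_eq_zero hu i hΨ
  have hint := integrableOn_rowDet_unitBall hu.integrable_gradient i hΨ
  have hcut : IntegrableOn (fun x => cutLog a n (‖x‖ ^ 2) * rowDet (Du x) i ψ x) unitBall := by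
    refine (integrableOn_rowDet_unitBall hu.integrable_gradient i hψ).bdd_mul
      (c := (2 * a)⁻¹)
      ((contDiff_cutLog ha n).continuous.comp (by fun_prop)).aestronglyMeasurable ?_
    filter_upwards [ae_restrict_mem measurableSet_unitBall] with x hx
    have hx1 : ‖x‖ < 1 := mem_ball_zero_iff.1 hx
    refine (norm_cutLog_le ha n _).trans (mul_le_of_le_one_right (by positivity) ?_)
    rw [abs_le]; constructor <;> nlinarith [norm_nonneg x]
  have h := integral_sub hcut hint
  rw [h0, sub_zero] at h
  rw [← h]
  refine integral_congr_ae (.of_forall fun x => ?_)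
  simp only [rowDet_radial_mul (hasDerivAt_cutLog ha n) hψ]
  ring

/-- Limit `n → ∞` at fixed `ε`: in the ball, `2|x|²` times the step weight tends to the indicator of
the annulus. -/
lemma integral_annulus_tau (hu : IsW11WithGradient u Du) (i : Fin m) {ψ : Plane → ℝ}
    (hψ : IsTest ψ) {ε : ℝ} (hε : 0 < ε) :
    ∫ x in annulus ε, tau Du x i * ψ x / ‖x‖ =
      ∫ x in unitBall, truncLog (ε ^ 2) (‖x‖ ^ 2) * rowDet (Du x) i ψ x := by
  have ha : 0 < ε ^ 2 := by positivity
  have hrow := integrableOn_rowDet_unitBall hu.integrable_gradient i hψ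
  have htau := integrableOn_tau_div_norm hu.integrable_gradient i hψ hε
  have hlim1 : Tendsto
      (fun n => ∫ x in unitBall, cutLog (ε ^ 2) n (‖x‖ ^ 2) * rowDet (Du x) i ψ x) atTop
      (𝓝 (∫ x in unitBall, truncLog (ε ^ 2) (‖x‖ ^ 2) * rowDet (Du x) i ψ x)) := by
    refine tendsto_integral_of_dominated_convergence
      (fun x => (2 * ε ^ 2)⁻¹ * ‖rowDet (Du x) i ψ x‖) (fun n => ?_) (hrow.norm.const_mul _)
      (fun n => ?_) (.of_forall fun x => (tendsto_cutLog ha _).mul_const _)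
    · exact (((contDiff_cutLog ha n).continuous.comp
        (by fun_prop : Continuous fun x : Plane => ‖x‖ ^ 2)).aestronglyMeasurable).mul
        hrow.aestronglyMeasurable
    · filter_upwards [ae_restrict_mem measurableSet_unitBall] with x hx
      have hx1 : ‖x‖ < 1 := mem_ball_zero_iff.1 hx
      rw [norm_mul]
      gcongr
      refine (norm_cutLog_le ha n _).trans (mul_le_of_le_one_right (by positivity) ?_)
      rw [abs_le]; constructor <;> nlinarith [norm_nonneg x]
  have hlim2 : Tendsto (fun n => ∫ x in unitBall,
      2 * ‖x‖ ^ 2 * stepWeight (ε ^ 2) n (‖x‖ ^ 2) * (tau Du x i * ψ x / ‖x‖)) atTop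
      (𝓝 (∫ x in unitBall, (annulus ε).indicator (fun x => tau Du x i * ψ x / ‖x‖) x)) := by
    have hout {x : Plane} (hx : x ∈ unitBall) (hxa : x ∉ annulus ε) : ‖x‖ ^ 2 ≤ ε ^ 2 := by
      have hx1 : ‖x‖ < 1 := mem_ball_zero_iff.1 hx
      have : ‖x‖ ≤ ε := not_lt.1 fun h => hxa ⟨h, hx1⟩
      gcongr
    refine tendsto_integral_of_dominated_convergence
      (fun x => ‖(annulus ε).indicator (fun x => tau Du x i * ψ x / ‖x‖) x‖) (fun n => ?_)
      (htau.integrable_indicator (measurableSet_annulus ε)).norm.integrableOn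
      (fun n => ?_) ?_
    · have hc := (contDiff_stepWeight ha n).continuous
      have hm : Continuous fun x : Plane => 2 * ‖x‖ ^ 2 * stepWeight (ε ^ 2) n (‖x‖ ^ 2) := by
        fun_prop
      refine hm.aestronglyMeasurable.mul ?_
      have := (aestronglyMeasurable_tau hu.integrable_gradient i).mul
        (hψ.smooth.continuous.aestronglyMeasurable)
      exact (this.aemeasurable.div measurable_norm.aemeasurable).aestronglyMeasurable
    · filter_upwards [ae_restrict_mem measurableSet_unitBall] with x hx
      by_cases hxa : x ∈ annulus ε
      · rw [Set.indicator_of_mem hxa, norm_mul]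
        exact mul_le_of_le_one_left (norm_nonneg _) (norm_two_mul_stepWeight_le ha n _)
      · simp [stepWeight_of_le (hout hx hxa)]
    · filter_upwards [ae_restrict_mem measurableSet_unitBall] with x hx
      by_cases hxa : x ∈ annulus ε
      · have hx0 : 0 < ‖x‖ := hε.trans hxa.1
        have hx2 : ‖x‖ ^ 2 ∈ Set.Ioi (ε ^ 2) := by
          have := hxa.1
          simp only [Set.mem_Ioi]
          gcongr
        have := tendsto_stepWeight (a := ε ^ 2) (‖x‖ ^ 2)
        rw [Set.indicator_of_mem hx2] at this
        have := (this.const_mul (2 * ‖x‖ ^ 2)).mul_const (tau Du x i * ψ x / ‖x‖)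
        rw [mul_inv_cancel₀ (by positivity), one_mul] at this
        rwa [Set.indicator_of_mem hxa]
      · simp [stepWeight_of_le (hout hx hxa), hxa]
  rw [setIntegral_indicator (measurableSet_annulus ε),
    Set.inter_eq_right.2 (annulus_subset_unitBall ε)] at hlim2
  simp_rw [integral_cutLog_mul_rowDet hu i hψ ha] at hlim1
  exact tendsto_nhds_unique hlim2 hlim1

/-- The exponent 1 is below the dimension 2. -/
lemma integrableOn_norm_inv : IntegrableOn (fun x : Plane => ‖x‖⁻¹) unitBall := by
  refine integrableOn_ball_of_norm_le_rpow (C := 1) (α := 1) (by simp) (by simp) ?_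
    measurable_norm.inv.aestronglyMeasurable
  exact .of_forall fun x => by simp [Real.rpow_neg_one]

lemma integrableOn_log_mul (hDu : IntegrableOn Du unitBall)
    (hlog : IntegrableOn (fun x => ‖Du x‖ * Real.log (2 + ‖Du x‖)) unitBall)
    (p : Fin m × Fin 2) : IntegrableOn (fun x => Real.log ‖x‖ * Du x p) unitBall := by
  have hdom := (hlog.const_mul 2).add (integrableOn_norm_inv.const_mul 2)
  refine hdom.mono' ?_ ?_
  · exact (Real.measurable_log.comp measurable_norm).aestronglyMeasurable.mul
      (integrableOn_entry hDu p).aestronglyMeasurable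
  · have h0 : ∀ᵐ x : Plane ∂volume.restrict unitBall, x ≠ 0 :=
      ae_restrict_of_ae (Measure.ae_ne volume 0)
    filter_upwards [ae_restrict_mem measurableSet_unitBall, h0] with x hx hx0
    have hx1 : ‖x‖ < 1 := mem_ball_zero_iff.1 hx
    have hpos : 0 < ‖x‖ := norm_pos_iff.2 hx0
    have hneg : Real.log ‖x‖ ≤ 0 := Real.log_nonpos hpos.le hx1.le
    have hexp : Real.exp |Real.log ‖x‖| = ‖x‖⁻¹ := by
      rw [abs_of_nonpos hneg, Real.exp_neg, Real.exp_log hpos]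
    -- With this `t` the exponential term is the integrable function `1/|x|`.
    have := mul_le_mul_log_add_exp (t := |Real.log ‖x‖|) (norm_nonneg (Du x))
    rw [hexp] at this
    rw [norm_mul]
    refine (mul_le_mul_of_nonneg_left (PiLp.norm_apply_le _ _) (norm_nonneg _)).trans ?_
    simpa using this

lemma hasImproperIntegral_tau (hu : IsW11WithGradient u Du)
    (hlog : IntegrableOn (fun x => ‖Du x‖ * Real.log (2 + ‖Du x‖)) unitBall) (i : Fin m)
    {ψ : Plane → ℝ} (hψ : IsTest ψ) :
    HasImproperIntegral (fun x => tau Du x i * ψ x / ‖x‖)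
      (∫ x in unitBall, Real.log ‖x‖ * rowDet (Du x) i ψ x) := by
  refine ⟨fun ε hε => integrableOn_tau_div_norm hu.integrable_gradient i hψ hε, ?_⟩
  have hrow := integrableOn_rowDet (integrableOn_log_mul hu.integrable_gradient hlog) i hψ
  have hrow' := integrableOn_rowDet_unitBall hu.integrable_gradient i hψ
  have h0 : ∀ᵐ x : Plane ∂volume.restrict unitBall, x ≠ 0 :=
    ae_restrict_of_ae (Measure.ae_ne volume 0)
  have hlogsq {x : Plane} : Real.log (‖x‖ ^ 2) / 2 = Real.log ‖x‖ := by
    rw [Real.log_pow]; push_cast; ring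
  refine (tendsto_integral_filter_of_dominated_convergence
    (F := fun ε x => truncLog (ε ^ 2) (‖x‖ ^ 2) * rowDet (Du x) i ψ x)
    (fun x => ‖Real.log ‖x‖ * rowDet (Du x) i ψ x‖) ?_ ?_ hrow.norm ?_).congr' ?_
  · filter_upwards [self_mem_nhdsWithin] with ε hε
    have ha : 0 < ε ^ 2 := pow_pos hε 2
    -- Measurability of the truncated logarithm comes from its smooth approximations.
    refine AEStronglyMeasurable.mul ?_ hrow'.aestronglyMeasurable
    refine aestronglyMeasurable_of_tendsto_ae atTop (fun n => ?_)
      (.of_forall fun x => tendsto_cutLog ha (‖x‖ ^ 2))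
    exact ((contDiff_cutLog ha n).continuous.comp (by fun_prop)).aestronglyMeasurable
  · filter_upwards [self_mem_nhdsWithin] with ε hε
    filter_upwards [h0] with x hx0
    have hpos : 0 < ‖x‖ := norm_pos_iff.2 hx0
    rw [norm_mul, norm_mul]
    gcongr
    exact (norm_truncLog_le (by positivity)).trans_eq (by rw [hlogsq, Real.norm_eq_abs])
  · filter_upwards [h0] with x hx0
    have hpos : 0 < ‖x‖ := norm_pos_iff.2 hx0
    refine tendsto_const_nhds.congr' ?_
    -- Once `ε < min(|x|, 1)` the truncated logarithm equals `ln|x|`, so the limit is of an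
    -- eventually constant function.
    filter_upwards [Ioo_mem_nhdsGT (lt_min hpos one_pos)] with ε hε
    have h1 : ε < ‖x‖ := hε.2.trans_le (min_le_left _ _)
    have h2 : ε < 1 := hε.2.trans_le (min_le_right _ _)
    rw [truncLog_of_lt (pow_pos hε.1 2) (pow_lt_one₀ hε.1.le h2 two_ne_zero)
      (pow_lt_pow_left₀ h1 hε.1.le two_ne_zero), hlogsq]
  · filter_upwards [self_mem_nhdsWithin] with ε hε using (integral_annulus_tau hu i hψ hε).symm

/-! ### Calculus of improper integrals -/

lemma HasImproperIntegral.sub {g h : Plane → ℝ} {a b : ℝ} (hg : HasImproperIntegral g a)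
    (hh : HasImproperIntegral h b) : HasImproperIntegral (fun x => g x - h x) (a - b) := by
  refine ⟨fun ε hε => (hg.1 ε hε).sub (hh.1 ε hε), (hg.2.sub hh.2).congr' ?_⟩
  filter_upwards [self_mem_nhdsWithin] with ε hε
  exact (integral_sub (hg.1 ε hε) (hh.1 ε hε)).symm

lemma HasImproperIntegral.add {g h : Plane → ℝ} {a b : ℝ} (hg : HasImproperIntegral g a)
    (hh : HasImproperIntegral h b) : HasImproperIntegral (fun x => g x + h x) (a + b) := by
  refine ⟨fun ε hε => (hg.1 ε hε).add (hh.1 ε hε), (hg.2.add hh.2).congr' ?_⟩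
  filter_upwards [self_mem_nhdsWithin] with ε hε
  exact (integral_add (hg.1 ε hε) (hh.1 ε hε)).symm

lemma HasImproperIntegral.const_mul {g : Plane → ℝ} {a : ℝ} (hg : HasImproperIntegral g a)
    (c : ℝ) : HasImproperIntegral (fun x => c * g x) (c * a) :=
  ⟨fun ε hε => (hg.1 ε hε).const_mul c,
    by simpa only [integral_const_mul] using hg.2.const_mul c⟩

lemma HasImproperIntegral.sum {ι : Type*} (s : Finset ι) {g : ι → Plane → ℝ} {a : ι → ℝ}
    (hg : ∀ k ∈ s, HasImproperIntegral (g k) (a k)) :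
    HasImproperIntegral (fun x => ∑ k ∈ s, g k x) (∑ k ∈ s, a k) := by
  refine ⟨fun ε hε => integrable_finsetSum s fun k hk => (hg k hk).1 ε hε,
    (tendsto_finsetSum s fun k hk => (hg k hk).2).congr' ?_⟩
  filter_upwards [self_mem_nhdsWithin] with ε hε
  exact (integral_finsetSum s fun k hk => (hg k hk).1 ε hε).symm

lemma HasImproperIntegral.unique {g : Plane → ℝ} {a b : ℝ} (ha : HasImproperIntegral g a)
    (hb : HasImproperIntegral g b) : a = b :=
  tendsto_nhds_unique ha.2 hb.2

lemma hasImproperIntegral_of_integrableOn {g : Plane → ℝ} (hg : IntegrableOn g unitBall) :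
    HasImproperIntegral g (∫ x in unitBall, g x) := by
  refine ⟨fun ε _ => hg.mono_set (annulus_subset_unitBall ε), ?_⟩
  have key (ε : ℝ) : ∫ x in annulus ε, g x = ∫ x in unitBall, (annulus ε).indicator g x := by
    rw [setIntegral_indicator (measurableSet_annulus ε),
      Set.inter_eq_right.2 (annulus_subset_unitBall ε)]
  simp_rw [key]
  refine tendsto_integral_filter_of_dominated_convergence (fun x => ‖g x‖)
    (.of_forall fun ε => hg.aestronglyMeasurable.indicator (measurableSet_annulus ε))
    (.of_forall fun ε => .of_forall fun x => norm_indicator_le_norm_self _ _) hg.norm ?_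
  have h0 : ∀ᵐ x : Plane ∂volume.restrict unitBall, x ≠ 0 :=
    ae_restrict_of_ae (Measure.ae_ne volume 0)
  filter_upwards [ae_restrict_mem measurableSet_unitBall, h0] with x hx hx0
  refine tendsto_const_nhds.congr' ?_
  filter_upwards [Ioo_mem_nhdsGT (norm_pos_iff.2 hx0)] with ε hε
  exact (Set.indicator_of_mem (show x ∈ annulus ε from ⟨hε.2, mem_ball_zero_iff.1 hx⟩) g).symm

/-! ### Derivatives of the minors, and assembly of (a) and (b) -/

lemma inner_gradient_H (i j : Fin m) (F G : Mat m) :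
    inner ℝ (gradient (H i j) F) G =
      G (i, 0) * F (j, 1) + F (i, 0) * G (j, 1) - G (i, 1) * F (j, 0) - F (i, 1) * G (j, 0) := by
  rw [inner_gradient_left]
  have hp (p : Fin m × Fin 2) : HasFDerivAt (fun F : Mat m => F p)
      (EuclideanSpace.proj p : Mat m →L[ℝ] ℝ) F :=
    (EuclideanSpace.proj p : Mat m →L[ℝ] ℝ).hasFDerivAt
  have h := ((hp (i, 0)).mul (hp (j, 1))).sub ((hp (i, 1)).mul (hp (j, 0)))
  have hH : HasFDerivAt (H i j) _ F := h.congr_of_eventuallyEq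
    (.of_forall fun F => by simp [H, sub, Matrix.det_fin_two])
  rw [hH.fderiv]
  simp
  ring

lemma dot2_cof_sub (i j : Fin m) (F G : Mat m) :
    dot2 (cof (sub i j F)) (sub i j G) = inner ℝ (gradient (H i j) F) G := by
  rw [inner_gradient_H]
  simp [dot2, cof, sub, Matrix.adjugate_fin_two, Matrix.trace_fin_two]
  ring

lemma inner_gradient_H_grad {φ : Plane → Vec m} (hφ : IsTest φ) (i j : Fin m) (F : Mat m)
    (x : Plane) : inner ℝ (gradient (H i j) F) (grad φ x) =
      rowDet F i (fun y => φ y j) x - rowDet F j (fun y => φ y i) x := by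
  simp only [inner_gradient_H, grad_apply hφ, rowDet]
  ring

lemma log_mul_inner_gradient_H (hu : IsW11WithGradient u Du)
    (hlog : IntegrableOn (fun x => ‖Du x‖ * Real.log (2 + ‖Du x‖)) unitBall) (i j : Fin m)
    {φ : Plane → Vec m} (hφ : IsTest φ) :
    IntegrableOn (fun x => Real.log ‖x‖ * inner ℝ (gradient (H i j) (Du x)) (grad φ x)) unitBall ∧
      HasImproperIntegral (fun x => (tau Du x i * φ x j - tau Du x j * φ x i) / ‖x‖)
        (∫ x in unitBall, Real.log ‖x‖ * inner ℝ (gradient (H i j) (Du x)) (grad φ x)) := by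
  have hint := integrableOn_log_mul hu.integrable_gradient hlog
  have hi := integrableOn_rowDet hint i (isTest_coord hφ j)
  have hj := integrableOn_rowDet hint j (isTest_coord hφ i)
  simp_rw [inner_gradient_H_grad hφ, mul_sub, sub_div]
  refine ⟨hi.sub hj, ?_⟩
  rw [integral_sub hi hj]
  exact (hasImproperIntegral_tau hu hlog i (isTest_coord hφ j)).sub
    (hasImproperIntegral_tau hu hlog j (isTest_coord hφ i))

/-- Antisymmetry: exchanging the indices in the lower triangular half of the sum pairs `(i, j)` with
`(j, i)`. -/
lemma sum_Lam_mulVec_mul (lam : Fin m → Fin m → ℝ) (v w : Fin m → ℝ) :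
    ∑ i, (Lam lam).mulVec v i * w i =
      -∑ i, ∑ j ∈ Finset.Ioi i, lam i j * (v i * w j - v j * w i) := by
  have h (i j : Fin m) : Lam lam i j * v j * w i =
      (if i < j then lam i j * (v j * w i) else 0) -
        (if j < i then lam j i * (v j * w i) else 0) := by
    rcases lt_trichotomy i j with h | h | h
    · simp [Lam, h, h.not_gt]; ring
    · simp [Lam, h]
    · simp [Lam, h, h.not_gt]; ring
  have hIoi (i : Fin m) : Finset.Ioi i = Finset.univ.filter (i < ·) := by ext; simp
  simp only [Matrix.mulVec, dotProduct, Finset.sum_mul, h, Finset.sum_sub_distrib, hIoi,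
    Finset.sum_filter]
  rw [Finset.sum_comm (f := fun i j => if j < i then lam j i * (v j * w i) else 0),
    ← Finset.sum_sub_distrib, ← Finset.sum_neg_distrib]
  refine Finset.sum_congr rfl fun i _ => ?_
  rw [← Finset.sum_sub_distrib, ← Finset.sum_neg_distrib]
  refine Finset.sum_congr rfl fun j _ => ?_
  split_ifs <;> ring

lemma integrableOn_inner_grad {G : Plane → Mat m} (hG : IntegrableOn G unitBall)
    {φ : Plane → Vec m} (hφ : IsTest φ) :
    IntegrableOn (fun x => inner ℝ (G x) (grad φ x)) unitBall := by
  simp only [PiLp.inner_apply, grad_apply hφ]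
  refine integrable_finsetSum _ fun p _ => ?_
  have := ((isTest_coord hφ p.1).fderiv_apply (EuclideanSpace.single p.2 1)).integrableOn_mul
    (integrableOn_entry hG p)
  simpa [IntegrableOn, mul_comm] using this

lemma elIntegrand_reducedIntegrand (hu : IsW11WithGradient u Du)
    (hlog : IntegrableOn (fun x => ‖Du x‖ * Real.log (2 + ‖Du x‖)) unitBall)
    {f : ℝ → ℝ} (lam : Fin m → Fin m → ℝ)
    (hf : IntegrableOn (fun x => gradient (gam f) (Du x)) unitBall)
    {φ : Plane → Vec m} (hφ : IsTest φ) :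
    IntegrableOn (elIntegrand f lam Du φ) unitBall ∧
      HasImproperIntegral (reducedIntegrand f lam Du φ)
        (∫ x in unitBall, elIntegrand f lam Du φ x) := by
  have hγ := integrableOn_inner_grad hf hφ
  have hH (i j : Fin m) := log_mul_inner_gradient_H hu hlog i j hφ
  have hsum (i : Fin m) : IntegrableOn (fun x => ∑ j ∈ Finset.Ioi i,
      lam i j * (Real.log ‖x‖ * inner ℝ (gradient (H i j) (Du x)) (grad φ x))) unitBall :=
    integrable_finsetSum _ fun j _ => (hH i j).1.const_mul _
  have hel : elIntegrand f lam Du φ = fun x => inner ℝ (gradient (gam f) (Du x)) (grad φ x) +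
      ∑ i, ∑ j ∈ Finset.Ioi i,
        lam i j * (Real.log ‖x‖ * inner ℝ (gradient (H i j) (Du x)) (grad φ x)) := by
    funext x
    simp only [elIntegrand, dot2_cof_sub]
  have hred : reducedIntegrand f lam Du φ =
      fun x => inner ℝ (gradient (gam f) (Du x)) (grad φ x) + ∑ i, ∑ j ∈ Finset.Ioi i,
        lam i j * ((tau Du x i * φ x j - tau Du x j * φ x i) / ‖x‖) := by
    funext x
    rw [reducedIntegrand, sum_Lam_mulVec_mul]
    simp only [neg_div, sub_neg_eq_add, Finset.sum_div, mul_div_assoc]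
  have hall := integrable_finsetSum Finset.univ fun i _ => hsum i
  rw [hel, hred]
  refine ⟨hγ.add hall, ?_⟩
  rw [integral_add hγ hall, integral_finsetSum _ fun i _ => hsum i]
  refine (hasImproperIntegral_of_integrableOn hγ).add (.sum _ fun i _ => ?_)
  rw [integral_finsetSum _ fun j _ => (hH i j).1.const_mul _]
  refine .sum _ fun j _ => ?_
  rw [integral_const_mul]
  exact (hH i j).2.const_mul _

/-- For each `φ` the reduced improper integral equals the Euler-Lagrange integral, so uniqueness of
limits makes them vanish together. -/
lemma isCriticalPoint_iff (hu : IsW11WithGradient u Du)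
    (hlog : IntegrableOn (fun x => ‖Du x‖ * Real.log (2 + ‖Du x‖)) unitBall)
    {f : ℝ → ℝ} (lam : Fin m → Fin m → ℝ)
    (hf : IntegrableOn (fun x => gradient (gam f) (Du x)) unitBall) :
    IsCriticalPoint f lam Du ↔
      ∀ φ : Plane → Vec m, IsTest φ → HasImproperIntegral (reducedIntegrand f lam Du φ) 0 := by
  refine forall₂_congr fun φ hφ => ?_
  obtain ⟨hint, himp⟩ := elIntegrand_reducedIntegrand hu hlog lam hf hφ
  exact ⟨fun h => h.2 ▸ himp, fun h => ⟨hint, himp.unique h⟩⟩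

end OneHomog

end

theorem lemma2p1 {m : ℕ} (u : OneHomog.Plane → OneHomog.Vec m)
    (Du : OneHomog.Plane → OneHomog.Mat m)
    (hu : OneHomog.IsW11WithGradient u Du)
    (hlog : IntegrableOn (fun x => ‖Du x‖ * Real.log (2 + ‖Du x‖)) OneHomog.unitBall) :
    -- part (a)
    (∀ i j : Fin m, i < j → ∀ φ : OneHomog.Plane → OneHomog.Vec m, OneHomog.IsTest φ →
      IntegrableOn
        (fun x => Real.log ‖x‖ *
          inner ℝ (gradient (OneHomog.H i j) (Du x)) (OneHomog.grad φ x)) OneHomog.unitBall ∧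
      OneHomog.HasImproperIntegral
        (fun x => (OneHomog.tau Du x i * φ x j - OneHomog.tau Du x j * φ x i) / ‖x‖)
        (∫ x in OneHomog.unitBall, Real.log ‖x‖ *
          inner ℝ (gradient (OneHomog.H i j) (Du x)) (OneHomog.grad φ x))) ∧
    -- part (b)
    (∀ (f : ℝ → ℝ) (lam : Fin m → Fin m → ℝ),
      (∀ᵐ x ∂(volume.restrict OneHomog.unitBall),
        DifferentiableAt ℝ (OneHomog.gam (m := m) f) (Du x)) →
      IntegrableOn (fun x => gradient (OneHomog.gam f) (Du x)) OneHomog.unitBall →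
      (∀ φ : OneHomog.Plane → OneHomog.Vec m, OneHomog.IsTest φ →
        IntegrableOn (OneHomog.elIntegrand f lam Du φ) OneHomog.unitBall ∧
        OneHomog.HasImproperIntegral (OneHomog.reducedIntegrand f lam Du φ)
          (∫ x in OneHomog.unitBall, OneHomog.elIntegrand f lam Du φ x)) ∧
      (OneHomog.IsCriticalPoint f lam Du ↔
        ∀ φ : OneHomog.Plane → OneHomog.Vec m, OneHomog.IsTest φ →
          OneHomog.HasImproperIntegral (OneHomog.reducedIntegrand f lam Du φ) 0)) := by
  exact ⟨fun i j _ φ hφ => OneHomog.log_mul_inner_gradient_H hu hlog i j hφ,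
    fun f lam _ hf =>
      ⟨fun φ hφ => OneHomog.elIntegrand_reducedIntegrand hu hlog lam hf hφ,
        OneHomog.isCriticalPoint_iff hu hlog lam hf⟩⟩
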